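/- Let $A$ be a finite totally ordered alphabet and $A^*$ the set of words on $A$. A column is a subset $\gamma$ of $A$. A letter $a$ acts on columns by column insertion: if some element of $\gamma$ is $\ge a$, then $a\cdot\gamma=(\gamma\setminus\{y\})\cup\{a\}$ with $y$ the smallest such element; otherwise $a\cdot\gamma=\gamma\cup\{a\}$. Words act on the left by $(uv)\cdot\gamma=u\cdot(v\cdot\gamma)$. The stylic monoid $\mathrm{Styl}(A)$ is the monoid of maps $\gamma\mapsto w\cdot\gamma$, $w\in A^*$, and $\mu:A^*\to\mathrm{Styl}(A)$ is the canonical homomorphism. An $N$-tableau is a semistandard Young tableau on $A$ (French notation, possibly empty; rows $R_1,\dots,R_k$ listed from bottom to top) whose rows are strictly increasing and such that each row is contained in the row below it; its rows are thus viewed as subsets of $A$. Its row-word $r(T)$ is obtained by reading the rows from left to right, starting with the highest one. The $N$-insertion of a letter $x$ into an $N$-tableau replaces the first row $R_1$ by $R_1\cup\{x\}$ and, if $R_1$ has an element $>x$, inserts in the same way (a copy of) the smallest such element into the second row, and so on (a missing row counts as empty). $N(w)$ is obtained by $N$-inserting the letters of $w$ successively, from left to right, starting with the empty tableau. For an $N$-tableau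 $T$ with rows $R_1,\dots,R_k$ and a letter $x$, let $p_i=\min R_i$, let $y_i$ be the smallest element of $R_i$ that is $>x$ (if it exists), and let $r$ be the largest $i$ with $x\in R_i$ ($r=0$ if there is none). The left insertion $x\to T$ is defined as follows. 1. If $T$ is empty or $x\le p_1$: replace $R_1$ by $R_1\cup\{x\}$ (with $R_1=\emptyset$ if $T$ is empty). 2. Otherwise let $t=t'+1$, where $t'$ is the largest $i$ with $x>p_i$. If $t\le k$ and $x=p_t$, then $x\to T=T$. 3. In the remaining case (with $R_{k+1}=\emptyset$), add $x$ to the rows $R_{r+1},\dots,R_t$, and, for each $i$ with $r+2\le i\le t$ such that $y_i$ and $y_{i-1}$ both exist in $T$ and are equal, remove $y_i$ from $R_i$. **Theorem.** For every $N$-tableau $T$ on $A$ and every letter $x\in A$, $x\to T$ is an $N$-tableau and $$x\to T=N(x\,r(T)).$$ Moreover, this is left multiplication in $\mathrm{Styl}(A)$: there is a bijection $\Phi$ from $\mathrm{Styl}(A)$ onto the set of $N$-tableaux on $A$ with $\Phi(\mu(w))=N(w)$ for every word $w$ and $\Phi^{-1}(T)=\mu(r(T))$ for every $N$-tableau $T$,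 and it satisfies $\Phi(\mu(x)\,m)=x\to\Phi(m)$ for all letters $x$ and all $m\in\mathrm{Styl}(A)$. -/

import Mathlib

namespace Stylic

section

variable {A : Type*} [LinearOrder A]

/-! Words are elements of `FreeMonoid A`, columns are finite subsets of `A`, and a tableau is
the list of its rows, from the lowest one to the highest one, each row being the list of its
letters from left to right. -/

/-- (Semistandard Young) tableaux in French notation: nonempty rows whose lengths weakly decrease
from bottom to top, letters weakly increasing from left to right in each row and strictly
increasing from bottom to top in each column. -/
def IsTableau (T : List (List A)) : Prop :=
  (∀ R ∈ T, R ≠ [] ∧ R.Pairwise (· ≤ ·)) ∧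
  T.IsChain (fun R R' => R'.length ≤ R.length ∧
    ∀ (j : ℕ) (h : j < R.length) (h' : j < R'.length), R[j] < R'[j])

/-- An `N`-tableau is a tableau whose rows are strictly increasing and in which each row is
contained in the row below. -/
def IsNTableau (T : List (List A)) : Prop :=
  IsTableau T ∧ (∀ R ∈ T, R.Pairwise (· < ·)) ∧ T.IsChain (fun R R' => R' ⊆ R)

/-- The row-word `r(T)`: the rows are read from left to right, starting with the highest one. -/
def rowWord (T : List (List A)) : FreeMonoid A :=
  FreeMonoid.ofList T.reverse.flatten

/-- The smallest element of `B` that is `> x`; it is `⊤` if there is no such element. -/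
def above (x : A) (B : Finset A) : WithTop A :=
  (B.filter (fun y => x < y)).min

/-- `N`-insertion `T ← x`: replace the first row `R` by `R ∪ {x}` and, if `R` has a letter
`> x`, insert (a copy of) the smallest such letter into the remaining rows. -/
def nInsert : List (List A) → A → List (List A)
  | [], x => [[x]]
  | R :: T, x =>
      (insert x R.toFinset).sort (· ≤ ·) ::
        WithTop.recTopCoe (C := fun _ => List (List A)) T (fun y => nInsert T y)
          (above x R.toFinset)

/-- The `N`-algorithm: `N(w)` is obtained by `N`-inserting the letters of `w`, from left to right,
starting from the empty tableau. -/
def nAlg (w : FreeMonoid A) : List (List A) :=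
  w.toList.foldl nInsert []

/-- The `i`-th row of `T` viewed as a set, with rows numbered from `1`; it is empty when `T` has no
such row. -/
def row (T : List (List A)) : ℕ → Finset A
  | 0 => ∅
  | i + 1 => (T.getD i []).toFinset

/-- The rows `R 1, …, R n`, written as increasing words. -/
def ofRows (n : ℕ) (R : ℕ → Finset A) : List (List A) :=
  (List.range n).map (fun i => (R (i + 1)).sort (· ≤ ·))

/-- The left insertion `x → T`. Here `R i` is the `i`-th row, `p i` is its minimum (`⊤` for an empty
row), `y i` is the smallest element `> x` of `R i` (`⊤` if it does not exist), `r` is the largest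
`i` with `x ∈ R i` (`0` if there is none), and `t = t' + 1` where `t'` is the largest `i` with
`x > p i`. -/
def leftInsert (x : A) (T : List (List A)) : List (List A) :=
  let k := T.length
  let R := row T
  let p := fun i => (R i).min
  let y := fun i => above x (R i)
  let r := Nat.findGreatest (fun i => x ∈ R i) k
  let t := Nat.findGreatest (fun i => p i < (x : WithTop A)) k + 1
  if (x : WithTop A) ≤ p 1 then
    ofRows (max k 1) (fun i => if i = 1 then insert x (R i) else R i)
  else if p t ≤ (x : WithTop A) then
    T
  else
    ofRows (max k t) (fun i =>
      let R' := if r + 1 ≤ i ∧ i ≤ t then insert x (R i) else R i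
      if r + 2 ≤ i ∧ i ≤ t ∧ y i ≠ ⊤ ∧ y i = y (i - 1) then
        R'.filter (fun z => (z : WithTop A) ≠ y i)
      else R')

/-- Column insertion of the letter `x` into the column `γ`: `x` replaces the smallest element
`y ≥ x` of `γ`, and it is simply added if there is no such `y`. -/
def columnInsert (x : A) (γ : Finset A) : Finset A :=
  insert x (γ.filter (fun z => (z : WithTop A) ≠ (γ.filter (fun y => x ≤ y)).min))

variable (A)

/-- The left action of words on columns, as a monoid homomorphism into the monoid of endofunctions
(under composition) of the set of columns: a letter acts by column insertion. -/
def action : FreeMonoid A →* Function.End (Finset A) :=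
  FreeMonoid.lift (fun x => (columnInsert x : Function.End (Finset A)))

/-- The stylic monoid: the monoid of all endofunctions of the set of columns given by words. -/
abbrev Styl : Type _ := MonoidHom.mrange (action A)

variable {A}

/-- The canonical homomorphism `μ` from words onto the stylic monoid. -/
def mu : FreeMonoid A →* Styl A := (action A).mrangeRestrict

end

end Stylic

/-! Adjoin a bottom and a top to A and let letters act by column insertion on sequences whose
initial entry b is held fixed. A word w, acting last letter first on b, ⊤, ⊤, …, gives `wordPath w
b`; as in Schensted's theorem, its k-th entry (k ≥ 1) is the least first letter of a strictly
decreasing subword of w of length k with all letters > b. On any other sequence the result is a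
minimum of such paths (`foldr_seqInsert_lt`), so they determine the action on columns; conversely
the columns {z ≤ b} reveal them (`action_eq_iff`).

An N-tableau carries the same data: start at b and pick in each row, going upwards, the smallest
letter greater than the previous pick. N-insertion changes these paths exactly as appending a letter
changes those of a word, so N(w) has the paths of w (`nAlg_spec`). So does r(T) have those of T, and
nested rows are recovered as the points that paths visit (`IsNested.mem_iff`). Hence N(r(T)) = T,
and μ(w) = μ(w') iff N(w) = N(w') (`mu_eq_iff`), which gives the bijection.

Prepending x performs one column insertion on every path. Collecting the points then visited gives
the rows of N(x r(T)) (`mem_rows_nAlg_mul`), which are compared with the case definition of x → T.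
-/

namespace Stylic

section

variable {A : Type*}

/-! ### The extended alphabet and the smallest element above a bound -/

/-- Letters as elements of the order obtained from `A` by adding a bottom and a top. -/
def letter (z : A) : WithBot (WithTop A) := ((z : WithTop A) : WithBot (WithTop A))

@[simp] theorem letter_inj {y z : A} : letter y = letter z ↔ y = z := by simp [letter]

theorem mem_ite_filter {C : Prop} [Decidable C] {B : Finset A} {Q : A → Prop} [DecidablePred Q]
    {z : A} : z ∈ (if C then B.filter Q else B) ↔ z ∈ B ∧ (C → Q z) := by
  split_ifs with h <;> simp [h]

variable [LinearOrder A]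

@[simp] theorem letter_lt_letter {y z : A} : letter y < letter z ↔ y < z := by simp [letter]

@[simp] theorem letter_le_letter {y z : A} : letter y ≤ letter z ↔ y ≤ z := by simp [letter]

theorem letter_lt_top (z : A) : letter z < ⊤ := by
  simp only [letter]
  exact WithBot.coe_lt_coe.2 (WithTop.coe_lt_top z)

theorem bot_lt_letter (z : A) : ⊥ < letter z := WithBot.bot_lt_coe _

theorem exists_letter {e : WithBot (WithTop A)} (h : ⊥ < e) (h' : e < ⊤) :
    ∃ z, e = letter z := by
  induction e with
  | bot => exact absurd h (lt_irrefl _)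
  | coe e =>
    induction e with
    | top => exact absurd h' (lt_irrefl _)
    | coe z => exact ⟨z, rfl⟩

/-- The smallest element of `B` that is `> b`, with value `⊤` if there is none. -/
def up (b : WithBot (WithTop A)) (B : Finset A) : WithBot (WithTop A) :=
  (B.filter (fun z => b < letter z)).inf letter

theorem up_lt_iff {b : WithBot (WithTop A)} {B : Finset A} {a : WithBot (WithTop A)} :
    up b B < a ↔ ∃ z ∈ B, b < letter z ∧ letter z < a := by
  by_cases ha : a = ⊥
  · subst ha; simp
  · rw [up, Finset.inf_lt_iff]
    simp [and_assoc]

theorem le_up {b a : WithBot (WithTop A)} {B : Finset A} :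
    a ≤ up b B ↔ ∀ z ∈ B, b < letter z → a ≤ letter z := by
  simp [up, and_imp]

theorem up_le {b : WithBot (WithTop A)} {B : Finset A} {z : A} (hz : z ∈ B) (h : b < letter z) :
    up b B ≤ letter z := le_up.1 le_rfl z hz h

theorem self_le_up (b : WithBot (WithTop A)) (B : Finset A) : b ≤ up b B :=
  le_up.2 fun _ _ h => h.le

theorem exists_up_eq {b : WithBot (WithTop A)} {B : Finset A} (h : up b B < ⊤) :
    ∃ z ∈ B, b < letter z ∧ up b B = letter z := by
  obtain ⟨y, hy, hy', -⟩ := up_lt_iff.1 h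
  have hne : (B.filter (fun z => b < letter z)).Nonempty := ⟨y, by simp [hy, hy']⟩
  obtain ⟨m, hm, hm'⟩ := Finset.exists_mem_eq_inf _ hne (letter (A := A))
  rw [Finset.mem_filter] at hm
  exact ⟨m, hm.1, hm.2, hm'⟩

theorem self_lt_up {b : WithBot (WithTop A)} {B : Finset A} (h : b < ⊤) : b < up b B := by
  rcases (le_top : up b B ≤ ⊤).lt_or_eq with h' | h'
  · obtain ⟨z, -, hz, h2⟩ := exists_up_eq h'
    rwa [h2]
  · rwa [h']

theorem up_mono {b b' : WithBot (WithTop A)} {B B' : Finset A} (h : b ≤ b') (hB : B' ⊆ B) :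
    up b B ≤ up b' B' :=
  le_up.2 fun _ hz hz' => up_le (hB hz) (h.trans_lt hz')

theorem up_eq_letter {b : WithBot (WithTop A)} {B : Finset A} {z : A} :
    up b B = letter z ↔ z ∈ B ∧ b < letter z ∧ ∀ y ∈ B, b < letter y → z ≤ y := by
  constructor
  · intro h
    obtain ⟨y, hy, hy', he⟩ := exists_up_eq (h ▸ letter_lt_top z : up b B < ⊤)
    obtain rfl : z = y := letter_inj.1 (h.symm.trans he)
    exact ⟨hy, hy', fun y hy hy' => letter_le_letter.1 (h ▸ up_le hy hy')⟩
  · rintro ⟨hz, hb, hle⟩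
    exact le_antisymm (up_le hz hb) (le_up.2 fun y hy hy' => letter_le_letter.2 (hle y hy hy'))

@[simp] theorem up_empty (b : WithBot (WithTop A)) : up b ∅ = ⊤ := by simp [up]

theorem coe_above (x : A) (B : Finset A) :
    ((above x B : WithTop A) : WithBot (WithTop A)) = up (letter x) B := by
  rcases h : above x B with _ | z
  · symm
    rw [above] at h
    have h := Finset.min_eq_top.1 h
    simp only [up, letter_lt_letter, h, Finset.inf_empty]
    rfl
  · symm
    have h : above x B = (z : WithTop A) := h
    rw [above] at h
    have h1 := Finset.mem_of_min h
    rw [Finset.mem_filter] at h1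
    refine up_eq_letter.2 ⟨h1.1, letter_lt_letter.2 h1.2, fun y hy hy' => ?_⟩
    exact Finset.min_le_of_eq (by simp [hy, letter_lt_letter.1 hy']) h

/-! ### Paths, and column insertion on sequences -/

/-- The path from `b` through the sets `S 0, S 1, …`: each entry is the smallest element of the
corresponding set that is larger than the previous entry. -/
def path (S : ℕ → Finset A) (b : WithBot (WithTop A)) : ℕ → WithBot (WithTop A)
  | 0 => b
  | i + 1 => up (path S b i) (S i)

theorem path_mono (S : ℕ → Finset A) {b b' : WithBot (WithTop A)} (h : b ≤ b') (i : ℕ) :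
    path S b i ≤ path S b' i := by
  induction i with
  | zero => exact h
  | succ i ih => exact up_mono ih subset_rfl

theorem le_path (S : ℕ → Finset A) (b : WithBot (WithTop A)) (i : ℕ) : b ≤ path S b i := by
  induction i with
  | zero => exact le_rfl
  | succ i ih => exact ih.trans (self_le_up _ _)

theorem path_succ (S : ℕ → Finset A) (b : WithBot (WithTop A)) (i : ℕ) :
    path S b (i + 1) = path (fun j => S (j + 1)) (up b (S 0)) i := by
  induction i with
  | zero => rfl
  | succ i ih => rw [path, ih, path]

/-- Column insertion of `x` into a sequence with a fixed initial entry. -/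
def seqInsert (x : A) (c : ℕ → WithBot (WithTop A)) : ℕ → WithBot (WithTop A)
  | 0 => c 0
  | i + 1 => if c i < letter x then min (c (i + 1)) (letter x) else c (i + 1)

theorem seqInsert_succ_lt {x : A} {c : ℕ → WithBot (WithTop A)} {i : ℕ} {a : WithBot (WithTop A)} :
    seqInsert x c (i + 1) < a ↔ c (i + 1) < a ∨ (c i < letter x ∧ letter x < a) := by
  rw [seqInsert]
  split_ifs with h <;> simp [h]

/-- The sequence `b, ⊤, ⊤, …`. -/
def start (b : WithBot (WithTop A)) : ℕ → WithBot (WithTop A)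
  | 0 => b
  | _ + 1 => ⊤

/-- The sequence obtained from `b, ⊤, ⊤, …` by letting the letters of `w` act, the last one first. -/
def wordPath (w : List A) (b : WithBot (WithTop A)) : ℕ → WithBot (WithTop A) :=
  w.foldr seqInsert (start b)

/-- Superposition: the result of w is the pointwise minimum, over all j, of `wordPath w (c j)`
shifted by j. It is phrased through `· < a` so that minima become disjunctions. -/
theorem foldr_seqInsert_lt (w : List A) (c : ℕ → WithBot (WithTop A)) (i : ℕ)
    (a : WithBot (WithTop A)) :
    w.foldr seqInsert c i < a ↔ ∃ j k, j + k = i ∧ wordPath w (c j) k < a := by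
  induction w generalizing i a with
  | nil =>
    simp only [List.foldr_nil, wordPath]
    constructor
    · exact fun h => ⟨i, 0, rfl, h⟩
    · rintro ⟨j, k, rfl, h⟩
      cases k with
      | zero => exact h
      | succ k => exact absurd h not_top_lt
  | cons x w ih =>
    cases i with
    | zero =>
      have := ih 0 a
      simp only [List.foldr_cons, wordPath, seqInsert, Nat.add_eq_zero_iff] at this ⊢
      rw [this]
      constructor
      · rintro ⟨j, k, ⟨rfl, rfl⟩, h⟩; exact ⟨0, 0, ⟨rfl, rfl⟩, h⟩
      · rintro ⟨j, k, ⟨rfl, rfl⟩, h⟩; exact ⟨0, 0, ⟨rfl, rfl⟩, h⟩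
    | succ i =>
      rw [List.foldr_cons, seqInsert_succ_lt, ih, ih]
      constructor
      · rintro (⟨j, k, h, h'⟩ | ⟨⟨j, k, h, h'⟩, h2⟩)
        · cases k with
          | zero => exact ⟨j, 0, h, h'⟩
          | succ k => exact ⟨j, k + 1, h, seqInsert_succ_lt.2 (Or.inl h')⟩
        · exact ⟨j, k + 1, by omega, seqInsert_succ_lt.2 (Or.inr ⟨h', h2⟩)⟩
      · rintro ⟨j, k, h, h'⟩
        cases k with
        | zero => exact Or.inl ⟨j, 0, h, h'⟩
        | succ k =>
          rcases seqInsert_succ_lt.1 h' with h' | ⟨h', h2⟩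
          · exact Or.inl ⟨j, k + 1, h, h'⟩
          · exact Or.inr ⟨⟨j, k, by omega, h'⟩, h2⟩

theorem foldr_seqInsert_congr {w w' : List A} (h : ∀ b, wordPath w b = wordPath w' b)
    (c : ℕ → WithBot (WithTop A)) : w.foldr seqInsert c = w'.foldr seqInsert c := by
  funext i
  refine eq_of_forall_gt_iff fun a => ?_
  simp only [foldr_seqInsert_lt, h]

/-- The sequence `b, e, ⊤, ⊤, …`. -/
def startTwo (b e : WithBot (WithTop A)) : ℕ → WithBot (WithTop A)
  | 0 => b
  | 1 => e
  | _ + 2 => ⊤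

theorem wordPath_zero (w : List A) (b : WithBot (WithTop A)) : wordPath w b 0 = b := by
  induction w with
  | nil => rfl
  | cons x w ih => exact ih

theorem wordPath_top (w : List A) (i : ℕ) : wordPath w ⊤ i = ⊤ := by
  induction w generalizing i with
  | nil => cases i <;> rfl
  | cons x w ih =>
    cases i with
    | zero => exact ih 0
    | succ i =>
      change seqInsert x (wordPath w ⊤) (i + 1) = ⊤
      simp [seqInsert, ih]

/-- Only the shifts 0 and 1 contribute, since a path from ⊤ stays at ⊤. This is the effect of
appending one letter e, which acts first. -/
theorem foldr_startTwo_lt (w : List A) (b e : WithBot (WithTop A)) (i : ℕ)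
    (a : WithBot (WithTop A)) :
    w.foldr seqInsert (startTwo b e) (i + 1) < a ↔
      wordPath w b (i + 1) < a ∨ wordPath w e i < a := by
  rw [foldr_seqInsert_lt]
  constructor
  · rintro ⟨j, k, h, h'⟩
    match j, h, h' with
    | 0, h, h' => left; rwa [show k = i + 1 by omega] at h'
    | 1, h, h' => right; rwa [show k = i by omega] at h'
    | j + 2, h, h' => simp [startTwo, wordPath_top] at h'
  · rintro (h | h)
    · exact ⟨0, i + 1, by omega, h⟩
    · exact ⟨1, i, by omega, h⟩

theorem seqInsert_start (x : A) (b : WithBot (WithTop A)) :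
    seqInsert x (start b) = if b < letter x then startTwo b (letter x) else start b := by
  funext i
  match i with
  | 0 => split_ifs <;> rfl
  | 1 => by_cases h : b < letter x <;> simp [seqInsert, start, startTwo, h]
  | i + 2 => by_cases h : b < letter x <;> simp [seqInsert, start, startTwo, h]

theorem wordPath_append_singleton (w : List A) (x : A) (b : WithBot (WithTop A)) :
    wordPath (w ++ [x]) b =
      if b < letter x then w.foldr seqInsert (startTwo b (letter x)) else wordPath w b := by
  rw [wordPath, List.foldr_append, List.foldr_cons, List.foldr_nil, seqInsert_start]
  split_ifs <;> rfl

theorem foldr_zero (w : List A) (c : ℕ → WithBot (WithTop A)) :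
    w.foldr seqInsert c 0 = c 0 := by
  induction w with
  | nil => rfl
  | cons x w ih => exact ih

/-! ### Paths through nested sets -/

/-- Adding to each set the entry of the path of `x` that arrives there. -/
theorem path_insert {S S' : ℕ → Finset A} (hS : ∀ i, S (i + 1) ⊆ S i) {x : A}
    (hS' : ∀ i z, z ∈ S' i ↔ z ∈ S i ∨ path S (letter x) i = letter z)
    (b : WithBot (WithTop A)) (i : ℕ) (a : WithBot (WithTop A)) :
    path S' b (i + 1) < a ↔
      path S b (i + 1) < a ∨ (b < letter x ∧ path S (letter x) i < a) := by
  set q := path S (letter x) with hq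
  have key : ∀ e i a, up e (S' i) < a ↔ up e (S i) < a ∨ (e < q i ∧ q i < a) := by
    intro e i a
    simp only [up_lt_iff, hS']
    constructor
    · rintro ⟨z, h | h, h1, h2⟩
      · exact Or.inl ⟨z, h, h1, h2⟩
      · rw [h]; exact Or.inr ⟨h1, h2⟩
    · rintro (⟨z, h, h1, h2⟩ | ⟨h1, h2⟩)
      · exact ⟨z, Or.inl h, h1, h2⟩
      · obtain ⟨z, hz⟩ := exists_letter ((bot_le).trans_lt h1) (h2.trans_le le_top)
        rw [hz] at h1 h2
        exact ⟨z, Or.inr hz, h1, h2⟩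
  induction i generalizing a with
  | zero => exact key b 0 a
  | succ i ih =>
    rw [path, key]
    by_cases hb : b < letter x
    · simp only [hb, true_and] at ih ⊢
      have hmin : path S' b (i + 1) = min (path S b (i + 1)) (q i) :=
        eq_of_forall_gt_iff fun a => (ih a).trans min_lt_iff.symm
      rw [hmin]
      constructor
      · rintro (h | h)
        · rcases min_choice (path S b (i + 1)) (q i) with h' | h'
          -- Nestedness enters here: a step from `q i` into the smaller set `S (i + 1)` cannot land
          -- below `q (i + 1)`, the step into `S i`.
          · rw [h'] at h; exact Or.inl h
          · rw [h'] at h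
            exact Or.inr ((up_mono le_rfl (hS i)).trans_lt h)
        · exact Or.inr h.2
      · rintro (h | h)
        · exact Or.inl ((up_mono (min_le_left _ _) subset_rfl).trans_lt h)
        · refine Or.inr ⟨(min_le_right _ _).trans_lt (self_lt_up ?_), h⟩
          exact ((self_le_up (q i) (S i)).trans_lt h).trans_le le_top
    · simp only [hb, false_and, or_false] at ih ⊢
      have : path S' b (i + 1) = path S b (i + 1) := eq_of_forall_gt_iff fun a => ih a
      rw [this]
      -- A path starting at or above x stays weakly above the path of x, so the added letters never
      -- serve it.
      have h2 : ¬ path S b (i + 1) < q (i + 1) := not_lt.2 (path_mono S (not_lt.1 hb) _)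
      simp only [h2, false_and, or_false]
      rfl

/-- The sets are nested, and the minimum of each is not in the next one. -/
def IsNested (S : ℕ → Finset A) : Prop :=
  ∀ i, ∀ z ∈ S (i + 1), z ∈ S i ∧ ∃ u ∈ S i, u < z

theorem IsNested.subset {S : ℕ → Finset A} (h : IsNested S) (i : ℕ) : S (i + 1) ⊆ S i :=
  fun z hz => (h i z hz).1

theorem exists_pred {B : Finset A} {z : A} {u : A} (hu : u ∈ B) (huz : u < z) :
    ∃ v ∈ B, u ≤ v ∧ v < z ∧ ∀ y ∈ B, v < y → z ≤ y := by
  have hne : (B.filter (· < z)).Nonempty := ⟨u, by simp [hu, huz]⟩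
  have hm := Finset.max'_mem _ hne
  rw [Finset.mem_filter] at hm
  refine ⟨_, hm.1, Finset.le_max' _ _ (by simp [hu, huz]), hm.2, fun y hy hy' => ?_⟩
  by_contra hc
  exact absurd (Finset.le_max' (B.filter (· < z)) y (by simp [hy, not_le.1 hc])) (not_le.2 hy')

/-- Supplies a starting point for reaching z in the bottom row; z need not belong to B, which
matters when z is being inserted. -/
theorem exists_below (B : Finset A) (z : A) :
    ∃ b : WithBot (WithTop A), b < letter z ∧ ∀ y ∈ B, b < letter y → z ≤ y := by
  by_cases h : ∃ u ∈ B, u < z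
  · obtain ⟨u, hu, huz⟩ := h
    obtain ⟨v, -, -, h1, h2⟩ := exists_pred hu huz
    exact ⟨letter v, letter_lt_letter.2 h1, fun y hy hy' => h2 y hy (letter_lt_letter.1 hy')⟩
  · push Not at h
    exact ⟨⊥, bot_lt_letter z, fun y hy _ => h y hy⟩

/-- A letter z of `S (i + 1)` has a smaller letter in `S i`, hence a predecessor v there. By
induction some path visits v, and its next step is z because `S (i + 1) ⊆ S i`. -/
theorem IsNested.mem_iff {S : ℕ → Finset A} (h : IsNested S) (i : ℕ) (z : A) :
    z ∈ S i ↔ ∃ b, path S b (i + 1) = letter z := by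
  constructor
  · intro hz
    induction i generalizing z with
    | zero =>
      obtain ⟨b, hb, hb'⟩ := exists_below (S 0) z
      exact ⟨b, up_eq_letter.2 ⟨hz, hb, hb'⟩⟩
    | succ i ih =>
      obtain ⟨-, u, hu, huz⟩ := h i z hz
      obtain ⟨v, hv, -, h1, h2⟩ := exists_pred hu huz
      obtain ⟨b, hb⟩ := ih v hv
      refine ⟨b, ?_⟩
      rw [path, hb]
      exact up_eq_letter.2 ⟨hz, letter_lt_letter.2 h1,
        fun y hy hy' => h2 y (h.subset i hy) (letter_lt_letter.1 hy')⟩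
  · rintro ⟨b, hb⟩
    exact (up_eq_letter.1 hb).1

/-! ### The action on columns in terms of paths -/

theorem mem_columnInsert {x z : A} {γ : Finset A} :
    z ∈ columnInsert x γ ↔ z = x ∨ z ∈ γ ∧ (z < x ∨ ∃ y ∈ γ, x ≤ y ∧ y < z) := by
  rw [columnInsert, Finset.mem_insert, Finset.mem_filter]
  refine or_congr_right (and_congr_right fun hz => ?_)
  constructor
  · intro h
    by_contra! hc
    refine h (le_antisymm (Finset.le_min fun y hy => ?_) (Finset.min_le (by simp [hz, hc.1])))
    rw [Finset.mem_filter] at hy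
    exact WithTop.coe_le_coe.2 (hc.2 y hy.1 hy.2)
  · intro h heq
    have h1 := Finset.mem_of_min heq.symm
    rw [Finset.mem_filter] at h1
    rcases h with h | ⟨y, hy, hxy, hyz⟩
    · exact absurd h1.2 h.not_ge
    · exact absurd (Finset.min_le_of_eq (by simp [hy, hxy] : y ∈ γ.filter (x ≤ ·)) heq.symm)
        hyz.not_ge

/-- Paths through a column after column insertion of a letter. -/
theorem path_columnInsert (x : A) (γ : Finset A) {b : WithBot (WithTop A)}
    (hb : ∀ z, letter z ≤ b → z ∈ γ) :
    path (fun _ => columnInsert x γ) b = seqInsert x (path (fun _ => γ) b) := by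
  set c := path (fun _ => γ) b with hc
  have hc' : ∀ i, c (i + 1) = up (c i) γ := fun i => rfl
  funext i
  induction i with
  | zero => rfl
  | succ i ih =>
    refine eq_of_forall_gt_iff fun a => ?_
    rw [seqInsert_succ_lt, path, ih, hc', up_lt_iff, up_lt_iff]
    simp only [mem_columnInsert]
    by_cases h : c i < letter x
    · have he : seqInsert x c i = c i := by
        cases i with
        | zero => rfl
        | succ i =>
          rw [seqInsert, min_eq_left h.le, ite_self]
      rw [he]
      constructor
      · rintro ⟨z, rfl | ⟨hz, -⟩, h1, h2⟩
        · exact Or.inr ⟨h1, h2⟩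
        · exact Or.inl ⟨z, hz, h1, h2⟩
      · rintro (⟨z, hz, h1, h2⟩ | ⟨h1, h2⟩)
        · rcases lt_or_ge z x with hzx | hzx
          · exact ⟨z, Or.inr ⟨hz, Or.inl hzx⟩, h1, h2⟩
          · exact ⟨x, Or.inl rfl, h, (letter_le_letter.2 hzx).trans_lt h2⟩
        · exact ⟨x, Or.inl rfl, h1, h2⟩
    · simp only [h, false_and, or_false]
      rw [not_lt] at h
      constructor
      · rintro ⟨z, hz, h1, h2⟩
        have hx : letter x ≤ seqInsert x c i := by
          cases i with
          | zero => exact h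
          | succ i =>
            rw [seqInsert]
            split_ifs
            · exact le_min h le_rfl
            · exact h
        have hxz := letter_lt_letter.1 (hx.trans_lt h1)
        rcases hz with rfl | ⟨hz, hz' | ⟨y, hy, hxy, hyz⟩⟩
        · exact absurd hxz (lt_irrefl _)
        · exact absurd hxz hz'.not_gt
        · refine ⟨z, hz, ?_, h2⟩
          cases i with
          | zero => exact h1
          | succ i =>
            rw [seqInsert] at h1
            split_ifs at h1 with h3
            · exact (up_le hy (h3.trans_le (letter_le_letter.2 hxy))).trans_lt
                (letter_lt_letter.2 hyz)
            · exact h1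
      · rintro ⟨z, hz, h1, h2⟩
        -- The letter bumped by x must lie at or below `c i`. For i = 0 this is where `hb` is
        -- needed: otherwise an x ≤ b could bump a letter above b.
        have hy : ∃ y ∈ γ, x ≤ y ∧ letter y ≤ c i := by
          cases i with
          | zero => exact ⟨x, hb x h, le_rfl, h⟩
          | succ i =>
            obtain ⟨y, hy, -, hy'⟩ := exists_up_eq (h1.trans_le le_top)
            change c (i + 1) = letter y at hy'
            rw [hy', letter_le_letter] at h
            exact ⟨y, hy, h, hy'.ge⟩
        obtain ⟨y, hy, hxy, hyc⟩ := hy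
        refine ⟨z, Or.inr ⟨hz, Or.inr ⟨y, hy, hxy, letter_lt_letter.1 (hyc.trans_lt h1)⟩⟩, ?_, h2⟩
        refine lt_of_le_of_lt ?_ h1
        cases i with
        | zero => exact le_rfl
        | succ i =>
          rw [seqInsert]
          split_ifs
          · exact min_le_left _ _
          · exact le_rfl

theorem path_action (w : List A) (γ : Finset A) {b : WithBot (WithTop A)}
    (hb : ∀ z, letter z ≤ b → z ∈ γ) :
    path (fun _ => action A (FreeMonoid.ofList w) γ) b =
        w.foldr seqInsert (path (fun _ => γ) b) ∧
      ∀ z, letter z ≤ b → z ∈ action A (FreeMonoid.ofList w) γ := by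
  induction w with
  | nil => exact ⟨rfl, hb⟩
  | cons x w ih =>
    have h : action A (FreeMonoid.ofList (x :: w)) γ =
        columnInsert x (action A (FreeMonoid.ofList w) γ) := by
      have h1 : action A (FreeMonoid.of x) = columnInsert x := FreeMonoid.lift_eval_of _ _
      rw [FreeMonoid.ofList_cons, map_mul, ← h1]
      rfl
    rw [h, path_columnInsert x _ ih.2, ih.1]
    refine ⟨rfl, fun z hz => mem_columnInsert.2 ?_⟩
    rcases lt_trichotomy z x with hzx | hzx | hzx
    · exact Or.inr ⟨ih.2 z hz, Or.inl hzx⟩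
    · exact Or.inl hzx
    · exact Or.inr ⟨ih.2 z hz, Or.inr
        ⟨x, ih.2 x ((letter_le_letter.2 hzx.le).trans hz), le_rfl, hzx⟩⟩

theorem mem_iff_path_bot [WellFoundedLT A] (γ : Finset A) (z : A) :
    z ∈ γ ↔ ∃ i, path (fun _ => γ) ⊥ (i + 1) = letter z := by
  constructor
  · intro hz
    induction z using WellFoundedLT.induction with
    | ind z ih =>
      by_cases h : ∃ u ∈ γ, u < z
      · obtain ⟨u, hu, huz⟩ := h
        obtain ⟨v, hv, -, h1, h2⟩ := exists_pred hu huz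
        obtain ⟨i, hi⟩ := ih v h1 hv
        refine ⟨i + 1, ?_⟩
        rw [path, hi]
        exact up_eq_letter.2 ⟨hz, letter_lt_letter.2 h1,
          fun y hy hy' => h2 y hy (letter_lt_letter.1 hy')⟩
      · push Not at h
        exact ⟨0, up_eq_letter.2 ⟨hz, bot_lt_letter z, fun y hy _ => h y hy⟩⟩
  · rintro ⟨i, hi⟩
    exact (up_eq_letter.1 hi).1

/-- Two words act in the same way on columns if and only if they have the same paths. -/
theorem action_eq_iff [Finite A] (w w' : List A) :
    action A (FreeMonoid.ofList w) = action A (FreeMonoid.ofList w') ↔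
      ∀ b, wordPath w b = wordPath w' b := by
  constructor
  · intro h b
    have := Fintype.ofFinite A
    -- The test column {z ≤ b} has path b, ⊤, ⊤, … from b, so the action of w on it displays
    -- `wordPath w b`.
    have hb : ∀ z, letter z ≤ b → z ∈ Finset.univ.filter (fun z : A => letter z ≤ b) := by
      simp
    have hs : path (fun _ => Finset.univ.filter (fun z : A => letter z ≤ b)) b = start b := by
      have h0 : up b (Finset.univ.filter (fun z : A => letter z ≤ b)) = ⊤ := by
        rw [eq_top_iff, le_up]
        intro z hz hz'
        exact absurd hz' (not_lt.2 (by simpa using hz))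
      funext i
      induction i with
      | zero => rfl
      | succ i ih =>
        rw [path, ih]
        cases i with
        | zero => exact h0
        | succ i => exact eq_top_iff.2 (self_le_up _ _)
    have h1 := (path_action w _ hb).1
    have h2 := (path_action w' _ hb).1
    rw [hs] at h1 h2
    rw [h] at h1
    exact h1.symm.trans h2
  · intro h
    funext γ
    -- The path from ⊥ enumerates the whole column, and the saturation condition is vacuous there.
    have hb : ∀ z, letter z ≤ ⊥ → z ∈ γ := fun z hz => absurd (bot_lt_letter z) hz.not_gt
    ext z
    rw [mem_iff_path_bot, mem_iff_path_bot, (path_action w γ hb).1, (path_action w' γ hb).1,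
      foldr_seqInsert_congr h]

/-! ### N-tableaux as nested sequences of sets -/

/-- The rows of a tableau, viewed as sets and numbered from `0`. -/
def rows (T : List (List A)) (i : ℕ) : Finset A := row T (i + 1)

@[simp] theorem rows_nil (i : ℕ) : rows ([] : List (List A)) i = ∅ := rfl

@[simp] theorem rows_cons_zero (R : List A) (T : List (List A)) :
    rows (R :: T) 0 = R.toFinset := rfl

@[simp] theorem rows_cons_succ (R : List A) (T : List (List A)) (i : ℕ) :
    rows (R :: T) (i + 1) = rows T i := rfl

theorem mem_rows {T : List (List A)} {i : ℕ} {z : A} :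
    z ∈ rows T i ↔ ∃ h : i < T.length, z ∈ T[i] := by
  by_cases h : i < T.length
  · simp [rows, row, h]
  · simp [rows, row, h, List.getD]

/-- Nonempty strictly increasing rows. -/
def HasStrictRows (T : List (List A)) : Prop :=
  ∀ R ∈ T, R ≠ [] ∧ R.Pairwise (· < ·)

/-- The minimum of R is not in R', so R' is a sublist of the tail of R; its j-th letter sits at
position at least j in the tail, hence at least j + 1 in R. -/
theorem getElem_lt_of_subset_tail {R R' : List A} (hR : R.Pairwise (· < ·))
    (hR' : R'.Pairwise (· < ·)) (h : ∀ z ∈ R', z ∈ R ∧ ∃ u ∈ R, u < z) :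
    R'.length ≤ R.length ∧
      ∀ (j : ℕ) (h : j < R.length) (h' : j < R'.length), R[j] < R'[j] := by
  cases R with
  | nil =>
    have : R' = [] := List.eq_nil_iff_forall_not_mem.2 fun z hz => by simpa using (h z hz).1
    subst this
    simp
  | cons m R =>
    rw [List.pairwise_cons] at hR
    have hsub : R' ⊆ R := fun z hz => by
      obtain ⟨h1, u, hu, huz⟩ := h z hz
      rcases List.mem_cons.1 h1 with rfl | h1
      · rcases List.mem_cons.1 hu with rfl | hu
        · exact absurd huz (lt_irrefl _)
        · exact absurd huz (hR.1 u hu).not_gt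
      · exact h1
    have hs : R'.Sublist R :=
      List.sublist_of_subperm_of_pairwise (r := (· < ·))
        (List.subperm_of_subset (hR'.imp ne_of_lt) hsub) hR' hR.2
    refine ⟨hs.length_le.trans (by simp), fun j hj hj' => ?_⟩
    obtain ⟨f, hf⟩ := List.sublist_iff_exists_fin_orderEmbedding_get_eq.1 hs
    have h1 : R'[j] = R[(f ⟨j, hj'⟩ : ℕ)] := hf ⟨j, hj'⟩
    have h2 : j ≤ (f ⟨j, hj'⟩ : ℕ) := by
      have h3 : ∀ (j : ℕ) (hj : j < R'.length), j ≤ (f ⟨j, hj⟩ : ℕ) := by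
        intro j
        induction j with
        | zero => exact fun _ => Nat.zero_le _
        | succ j ih =>
          intro hj
          have h4 : f ⟨j, by omega⟩ < f ⟨j + 1, hj⟩ := f.strictMono (by simp)
          exact (ih (by omega)).trans_lt h4
      exact h3 j hj'
    have hp : (m :: R).Pairwise (· < ·) := List.pairwise_cons.2 hR
    rw [h1]
    exact List.pairwise_iff_getElem.1 hp j ((f ⟨j, hj'⟩ : ℕ) + 1) hj (by simp) (by omega)

theorem isNTableau_iff {T : List (List A)} :
    IsNTableau T ↔ HasStrictRows T ∧ IsNested (rows T) := by
  constructor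
  · rintro ⟨⟨h1, h2⟩, h3, h4⟩
    refine ⟨fun R hR => ⟨(h1 R hR).1, h3 R hR⟩, fun i z hz => ?_⟩
    rw [List.isChain_iff_getElem] at h2 h4
    obtain ⟨hi, hz⟩ := mem_rows.1 hz
    refine ⟨mem_rows.2 ⟨by omega, h4 i hi hz⟩, ?_⟩
    have hne : 0 < T[i + 1].length := List.length_pos_iff.2 (h1 _ (by simp)).1
    obtain ⟨hl, hlt⟩ := h2 i hi
    refine ⟨T[i][0]'(hne.trans_le hl), mem_rows.2 ⟨by omega, by simp⟩, ?_⟩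
    refine (hlt 0 (hne.trans_le hl) hne).trans_le ?_
    obtain ⟨j, hj, rfl⟩ := List.getElem_of_mem hz
    rcases Nat.eq_zero_or_pos j with rfl | h0
    · exact le_rfl
    · exact (List.pairwise_iff_getElem.1 (h3 _ (by simp : T[i + 1] ∈ T)) 0 j hne hj h0).le
  · rintro ⟨h1, h2⟩
    have key : ∀ i (hi : i + 1 < T.length), ∀ z ∈ T[i + 1], z ∈ T[i] ∧ ∃ u ∈ T[i], u < z := by
      intro i hi z hz
      obtain ⟨h3, u, hu, huz⟩ := h2 i z (mem_rows.2 ⟨hi, hz⟩)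
      exact ⟨(mem_rows.1 h3).2, u, (mem_rows.1 hu).2, huz⟩
    refine ⟨⟨fun R hR => ⟨(h1 R hR).1, (h1 R hR).2.imp le_of_lt⟩, ?_⟩,
      fun R hR => (h1 R hR).2, ?_⟩
    · exact List.isChain_iff_getElem.2 fun i hi =>
        getElem_lt_of_subset_tail (h1 _ (by simp)).2 (h1 _ (by simp)).2 (key i hi)
    · exact List.isChain_iff_getElem.2 fun i hi z hz => (key i hi z hz).1

/-! ### N-insertion along paths -/

theorem path_empty_succ {S : ℕ → Finset A} (hS : ∀ i, S i = ∅) (b : WithBot (WithTop A)) (i : ℕ) :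
    path S b (i + 1) = ⊤ := by
  rw [path, hS, up_empty]

theorem path_top (S : ℕ → Finset A) (i : ℕ) : path S ⊤ i = ⊤ :=
  eq_top_iff.2 (le_path S ⊤ i)

/-- The letters inserted into successive rows form the path of x; the value ⊤ encodes that the
insertion has stopped. -/
theorem mem_rows_nInsert (T : List (List A)) (x : A) (i : ℕ) (z : A) :
    z ∈ rows (nInsert T x) i ↔ z ∈ rows T i ∨ path (rows T) (letter x) i = letter z := by
  induction T generalizing x i with
  | nil =>
    cases i with
    | zero => simp [nInsert, path, eq_comm]
    | succ i =>
      rw [path_empty_succ (S := rows []) (fun _ => rfl)]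
      simpa [nInsert] using (letter_lt_top z).ne'
  | cons R T ih =>
    cases i with
    | zero => simp [nInsert, path, eq_comm, or_comm]
    | succ i =>
      rw [nInsert, path_succ]
      simp only [rows_cons_succ, rows_cons_zero]
      rw [← coe_above]
      rcases above x R.toFinset with _ | y
      · change z ∈ rows T i ↔ _ ∨ path (rows T) ⊤ i = letter z
        rw [path_top]
        simp [(letter_lt_top z).ne']
      · exact ih y i

theorem HasStrictRows.nInsert {T : List (List A)} (h : HasStrictRows T) (x : A) :
    HasStrictRows (nInsert T x) := by
  induction T generalizing x with
  | nil => simp [Stylic.nInsert, HasStrictRows]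
  | cons R T ih =>
    intro Q hQ
    rw [Stylic.nInsert, List.mem_cons] at hQ
    rcases hQ with rfl | hQ
    · refine ⟨fun h0 => ?_, (Finset.sortedLT_sort _).pairwise⟩
      have : x ∈ (insert x R.toFinset).sort (· ≤ ·) := by simp
      rw [h0] at this
      simp at this
    · have hT : HasStrictRows T := fun Q hQ => h Q (List.mem_cons_of_mem _ hQ)
      rcases hy : above x R.toFinset with _ | y
      · rw [hy] at hQ; exact hT Q hQ
      · rw [hy] at hQ; exact ih hT y Q hQ

theorem IsNTableau.nInsert {T : List (List A)} (h : IsNTableau T) (x : A) :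
    IsNTableau (nInsert T x) := by
  rw [isNTableau_iff] at h ⊢
  refine ⟨h.1.nInsert x, fun i z hz => ?_⟩
  simp only [mem_rows_nInsert] at hz ⊢
  rcases hz with hz | hz
  · obtain ⟨h1, u, hu, huz⟩ := h.2 i z hz
    exact ⟨Or.inl h1, u, Or.inl hu, huz⟩
  -- The new letter is a copy of one already in the row below, and the preceding entry of the path,
  -- now in that row, is smaller.
  · obtain ⟨h1, h2, -⟩ := up_eq_letter.1 hz
    obtain ⟨u, hu⟩ := exists_letter ((bot_lt_letter x).trans_le (le_path (rows T) _ i))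
      (h2.trans_le le_top)
    exact ⟨Or.inl h1, u, Or.inr hu, letter_lt_letter.1 (hu ▸ h2)⟩

theorem isNTableau_nil : IsNTableau ([] : List (List A)) :=
  isNTableau_iff.2 ⟨by simp [HasStrictRows], fun i z hz => by simp at hz⟩

/-- Induction on the last letter x: both sides become the minimum of the old path from b and, when b
< x, the old path from x shifted by one. -/
theorem nAlg_spec (w : List A) :
    IsNTableau (nAlg (FreeMonoid.ofList w)) ∧
      ∀ b, path (rows (nAlg (FreeMonoid.ofList w))) b = wordPath w b := by
  induction w using List.reverseRecOn with
  | nil =>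
    refine ⟨isNTableau_nil, fun b => ?_⟩
    funext i
    cases i with
    | zero => rfl
    | succ i => exact path_empty_succ (fun _ => rfl) b i
  | append_singleton w x ih =>
    have h : nAlg (FreeMonoid.ofList (w ++ [x])) = nInsert (nAlg (FreeMonoid.ofList w)) x := by
      simp [nAlg, List.foldl_append]
    rw [h]
    refine ⟨ih.1.nInsert x, fun b => ?_⟩
    funext i
    cases i with
    | zero => exact (wordPath_zero _ _).symm
    | succ i =>
      refine eq_of_forall_gt_iff fun a => ?_
      rw [path_insert (isNTableau_iff.1 ih.1).2.subset (mem_rows_nInsert _ x), ih.2, ih.2,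
        wordPath_append_singleton]
      split_ifs with hb
      · rw [foldr_startTwo_lt]; simp [hb]
      · simp [hb]

/-! ### Recovering tableaux from paths; row-words and the stylic congruence -/

theorem HasStrictRows.ext {T T' : List (List A)} (h : HasStrictRows T) (h' : HasStrictRows T')
    (heq : ∀ i, rows T i = rows T' i) : T = T' := by
  induction T generalizing T' with
  | nil =>
    cases T' with
    | nil => rfl
    | cons R' T' =>
      exact absurd (List.toFinset_eq_empty_iff R' |>.1 (heq 0).symm) (h' R' (by simp)).1
  | cons R T ih =>
    cases T' with
    | nil => exact absurd (List.toFinset_eq_empty_iff R |>.1 (heq 0)) (h R (by simp)).1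
    | cons R' T' =>
      have h0 : ∀ z, z ∈ R ↔ z ∈ R' := fun z => by simpa using Finset.ext_iff.1 (heq 0) z
      have h1 := (h R (by simp)).2
      have h2 := (h' R' (by simp)).2
      have hR : R = R' := List.Perm.eq_of_pairwise (le := (· < ·))
        (fun a b _ _ hab hba => absurd hab hba.not_gt) h1 h2
        ((List.perm_ext_iff_of_nodup (h1.imp ne_of_lt) (h2.imp ne_of_lt)).2 h0)
      rw [hR, ih (fun Q hQ => h Q (List.mem_cons_of_mem _ hQ))
        (fun Q hQ => h' Q (List.mem_cons_of_mem _ hQ)) fun i => heq (i + 1)]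

theorem IsNTableau.eq_of_path_eq {T T' : List (List A)} (h : IsNTableau T) (h' : IsNTableau T')
    (heq : ∀ b, path (rows T) b = path (rows T') b) : T = T' := by
  rw [isNTableau_iff] at h h'
  refine h.1.ext h'.1 fun i => ?_
  ext z
  rw [h.2.mem_iff, h'.2.mem_iff]
  simp only [heq]

/-- The letters of an increasing row act in decreasing order, so each letter > b replaces the
previous one and the smallest such letter remains. -/
theorem foldr_row (R : List A) (h : R.Pairwise (· < ·)) (b : WithBot (WithTop A)) :
    R.foldr seqInsert (start b) = startTwo b (up b R.toFinset) := by
  induction R with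
  | nil =>
    funext i
    match i with
    | 0 => rfl
    | 1 => exact (up_empty b).symm
    | i + 2 => rfl
  | cons x R ih =>
    rw [List.pairwise_cons] at h
    rw [List.foldr_cons, ih h.2]
    have hx : letter x ≤ up b R.toFinset :=
      le_up.2 fun z hz _ => letter_le_letter.2 (h.1 z (by simpa using hz)).le
    funext i
    match i with
    | 0 => rfl
    | 1 =>
      refine eq_of_forall_gt_iff fun a => ?_
      rw [seqInsert_succ_lt]
      simp only [startTwo, up_lt_iff]
      simp [or_comm]
    | i + 2 =>
      refine eq_of_forall_gt_iff fun a => ?_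
      rw [seqInsert_succ_lt]
      cases i <;> simp [startTwo, hx]

theorem path_le_path_succ {S : ℕ → Finset A} (hS : ∀ i, S (i + 1) ⊆ S i)
    (b : WithBot (WithTop A)) (i : ℕ) :
    path S b (i + 1) ≤ path (fun j => S (j + 1)) b (i + 1) := by
  induction i with
  | zero => exact up_mono le_rfl (hS 0)
  | succ i ih => exact up_mono ih (hS (i + 1))

theorem IsNTableau.of_cons {R : List A} {T : List (List A)} (h : IsNTableau (R :: T)) :
    IsNTableau T := by
  rw [isNTableau_iff] at h ⊢
  exact ⟨fun Q hQ => h.1 Q (List.mem_cons_of_mem _ hQ), fun i => h.2 (i + 1)⟩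

theorem IsNTableau.wordPath_rowWord {T : List (List A)} (h : IsNTableau T)
    (b : WithBot (WithTop A)) : wordPath (rowWord T).toList b = path (rows T) b := by
  induction T generalizing b with
  | nil =>
    funext i
    cases i with
    | zero => rfl
    | succ i => exact (path_empty_succ (fun _ => rfl) b i).symm
  | cons R T ih =>
    have h' := isNTableau_iff.1 h
    have hw : (rowWord (R :: T)).toList = (rowWord T).toList ++ R := by simp [rowWord]
    rw [hw, wordPath, List.foldr_append, foldr_row R (h'.1 R (by simp)).2]
    funext i
    cases i with
    | zero => exact foldr_zero _ _
    | succ i =>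
      refine eq_of_forall_gt_iff fun a => ?_
      -- Of the two superposed paths, the one that skips the bottom row is never lower, so the one
      -- through `R` gives the minimum.
      rw [foldr_startTwo_lt, ih h.of_cons, ih h.of_cons]
      have h1 : path (rows (R :: T)) b (i + 1) ≤ path (rows T) b (i + 1) :=
        path_le_path_succ h'.2.subset b i
      rw [path_succ (rows (R :: T))] at h1 ⊢
      exact ⟨fun h2 => h2.elim h1.trans_lt id, Or.inr⟩

theorem IsNTableau.nAlg_rowWord {T : List (List A)} (h : IsNTableau T) : nAlg (rowWord T) = T :=
  (nAlg_spec (rowWord T).toList).1.eq_of_path_eq h fun b => by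
    rw [(nAlg_spec (rowWord T).toList).2, h.wordPath_rowWord]

theorem mu_eq_iff [Finite A] (w w' : FreeMonoid A) : mu w = mu w' ↔ nAlg w = nAlg w' := by
  have h1 : IsNTableau (nAlg w) ∧ ∀ b, path (rows (nAlg w)) b = wordPath w.toList b :=
    nAlg_spec w.toList
  have h2 : IsNTableau (nAlg w') ∧ ∀ b, path (rows (nAlg w')) b = wordPath w'.toList b :=
    nAlg_spec w'.toList
  rw [mu, Subtype.ext_iff]
  refine (action_eq_iff w.toList w'.toList).trans ?_
  constructor
  · exact fun h => h1.1.eq_of_path_eq h2.1 fun b => by rw [h1.2, h2.2, h]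
  · intro h b
    rw [← h1.2, ← h2.2, h]

/-! ### Left insertion -/

theorem exists_mem_of_path_lt_top {S : ℕ → Finset A} {b : WithBot (WithTop A)} {i : ℕ}
    (h : path S b (i + 1) < ⊤) : ∃ u ∈ S i, path S b (i + 1) = letter u := by
  obtain ⟨u, hu, -, hu'⟩ := exists_up_eq h
  exact ⟨u, hu, hu'⟩

/-- The rows of `N(x r(T))`. -/
theorem mem_rows_nAlg_mul {T : List (List A)} (hT : IsNTableau T) (x : A) (i : ℕ) (z : A) :
    z ∈ rows (nAlg (FreeMonoid.of x * rowWord T)) i ↔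
      (z = x ∧ (i = 0 ∨ ∃ u ∈ row T i, u < x)) ∨
        (z ≠ x ∧ z ∈ row T (i + 1) ∧ (z < x ∨ i = 0 ∨ ∃ u ∈ row T i, x ≤ u ∧ u < z)) := by
  have hspec : IsNTableau (nAlg (FreeMonoid.of x * rowWord T)) ∧
      ∀ b, path (rows (nAlg (FreeMonoid.of x * rowWord T))) b =
        wordPath (x :: (rowWord T).toList) b := nAlg_spec (x :: (rowWord T).toList)
  have hp : ∀ b, wordPath (x :: (rowWord T).toList) b = seqInsert x (path (rows T) b) :=
    fun b => congrArg (seqInsert x) (hT.wordPath_rowWord b)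
  have hN := (isNTableau_iff.1 hT).2
  rw [(isNTableau_iff.1 hspec.1).2.mem_iff]
  simp only [hspec.2, hp, seqInsert]
  constructor
  · rintro ⟨b, hb⟩
    split_ifs at hb with h
    · have hx : i = 0 ∨ ∃ u ∈ row T i, u < x := by
        cases i with
        | zero => exact Or.inl rfl
        | succ j =>
          obtain ⟨u, hu, hu'⟩ := exists_mem_of_path_lt_top (h.trans_le le_top)
          rw [hu', letter_lt_letter] at h
          exact Or.inr ⟨u, hu, h⟩
      by_cases hzx : z = x
      · exact Or.inl ⟨hzx, hx⟩
      · rcases min_choice (path (rows T) b (i + 1)) (letter x) with h1 | h1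
        · have h2 : letter z ≤ letter x := hb ▸ min_le_right _ _
          rw [h1] at hb
          exact Or.inr ⟨hzx, (up_eq_letter.1 hb).1,
            Or.inl ((letter_le_letter.1 h2).lt_of_ne hzx)⟩
        · rw [h1, letter_inj] at hb
          exact absurd hb.symm hzx
    · obtain ⟨h1, h2, -⟩ := up_eq_letter.1 hb
      rw [not_lt] at h
      refine Or.inr ⟨(letter_lt_letter.1 (h.trans_lt h2)).ne', h1, Or.inr ?_⟩
      cases i with
      | zero => exact Or.inl rfl
      | succ j =>
        obtain ⟨u, hu, hu'⟩ := exists_mem_of_path_lt_top (h2.trans_le le_top)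
        rw [hu'] at h h2
        exact Or.inr ⟨u, hu, letter_le_letter.1 h, letter_lt_letter.1 h2⟩
  · rintro (⟨rfl, h⟩ | ⟨hzx, hz, h⟩)
    · have hb : ∃ b, path (rows T) b i < letter z ∧
          ∀ y ∈ rows T i, path (rows T) b i < letter y → z ≤ y := by
        cases i with
        | zero => exact exists_below _ _
        | succ j =>
          obtain ⟨u, hu, huz⟩ := h.resolve_left (Nat.succ_ne_zero j)
          obtain ⟨v, hv, -, h1, h2⟩ := exists_pred hu huz
          obtain ⟨b, hb⟩ := (hN.mem_iff j v).1 hv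
          refine ⟨b, ?_, fun y hy hy' => ?_⟩
          · rw [hb]; exact letter_lt_letter.2 h1
          · rw [hb] at hy'; exact h2 y (hN.subset j hy) (letter_lt_letter.1 hy')
      obtain ⟨b, hb, hb'⟩ := hb
      refine ⟨b, ?_⟩
      rw [if_pos hb]
      exact min_eq_right (le_up.2 fun y hy hy' => letter_le_letter.2 (hb' y hy hy'))
    · rcases lt_or_gt_of_ne hzx with h1 | h1
      · obtain ⟨b, hb⟩ := (hN.mem_iff i z).1 hz
        -- A path that reaches z < x is still below x there, so inserting x leaves this entry alone.
        refine ⟨b, ?_⟩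
        have h2 := letter_lt_letter.2 h1
        rw [if_pos (((self_le_up _ _).trans hb.le).trans_lt h2), hb, min_eq_left h2.le]
      · have hb : ∃ b, letter x ≤ path (rows T) b i ∧ path (rows T) b i < letter z ∧
            ∀ y ∈ rows T i, path (rows T) b i < letter y → z ≤ y := by
          cases i with
          | zero =>
            obtain ⟨b, hb, hb'⟩ := exists_below (rows T 0) z
            -- Starting no lower than x makes the insertion of x ineffective at the first entry.
            exact ⟨max b (letter x), le_max_right _ _, max_lt hb (letter_lt_letter.2 h1),
              fun y hy hy' => hb' y hy ((le_max_left _ _).trans_lt hy')⟩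
          | succ j =>
            obtain ⟨u, hu, hxu, huz⟩ :=
              (h.resolve_left h1.not_gt).resolve_left (Nat.succ_ne_zero j)
            obtain ⟨v, hv, huv, h1, h2⟩ := exists_pred hu huz
            obtain ⟨b, hb⟩ := (hN.mem_iff j v).1 hv
            refine ⟨b, ?_, ?_, fun y hy hy' => ?_⟩
            · rw [hb]; exact letter_le_letter.2 (hxu.trans huv)
            · rw [hb]; exact letter_lt_letter.2 h1
            · rw [hb] at hy'; exact h2 y (hN.subset j hy) (letter_lt_letter.1 hy')
        obtain ⟨b, hb, hb1, hb2⟩ := hb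
        refine ⟨b, ?_⟩
        rw [if_neg (not_lt.2 hb)]
        exact up_eq_letter.2 ⟨hz, hb1, hb2⟩

theorem above_eq_coe {x z : A} {B : Finset A} :
    above x B = (z : WithTop A) ↔ z ∈ B ∧ x < z ∧ ∀ y ∈ B, x < y → z ≤ y := by
  rw [← WithBot.coe_inj, coe_above]
  exact up_eq_letter.trans (by simp only [letter_lt_letter])

theorem min_lt_coe {B : Finset A} {x : A} : B.min < (x : WithTop A) ↔ ∃ u ∈ B, u < x := by
  constructor
  · intro h
    obtain ⟨u, hu⟩ := WithTop.ne_top_iff_exists.1 (h.trans_le le_top).ne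
    exact ⟨u, Finset.mem_of_min hu.symm, WithTop.coe_lt_coe.1 (hu ▸ h)⟩
  · rintro ⟨u, hu, h⟩
    exact (Finset.min_le hu).trans_lt (WithTop.coe_lt_coe.2 h)

/-- By nestedness, the rows with a letter < x, and likewise those containing x, form an initial
segment; this turns both properties into comparisons with t' and r. -/
theorem iff_le_findGreatest {P : ℕ → Prop} [DecidablePred P] {k : ℕ} (h0 : ¬ P 0)
    (hk : ∀ i, P i → i ≤ k) (hP : ∀ i, 1 ≤ i → P (i + 1) → P i) (i : ℕ) :
    P i ↔ 1 ≤ i ∧ i ≤ Nat.findGreatest P k := by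
  constructor
  · intro h
    exact ⟨Nat.one_le_iff_ne_zero.2 fun hi => h0 (hi ▸ h), Nat.le_findGreatest (hk i h) h⟩
  · rintro ⟨h1, h2⟩
    have h3 : P (Nat.findGreatest P k) := Nat.findGreatest_of_ne_zero rfl (by omega)
    exact Nat.decreasingInduction' (P := P) (fun j _ hj => hP j (h1.trans hj)) h2 h3

theorem rows_ofRows (n : ℕ) (F : ℕ → Finset A) (i : ℕ) :
    rows (ofRows n F) i = if i < n then F (i + 1) else ∅ := by
  by_cases h : i < n <;> simp [rows, row, ofRows, h, List.getD]

theorem HasStrictRows.ofRows_eq {T : List (List A)} (hT : HasStrictRows T) {n : ℕ}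
    {F : ℕ → Finset A} (hF : ∀ i < n, (F (i + 1)).Nonempty) (hF' : ∀ i, n ≤ i → F (i + 1) = ∅)
    (h : ∀ i, F (i + 1) = rows T i) : ofRows n F = T := by
  refine HasStrictRows.ext ?_ hT fun i => ?_
  · intro R hR
    obtain ⟨i, hi, rfl⟩ := List.mem_map.1 hR
    rw [List.mem_range] at hi
    refine ⟨fun h0 => ?_, (Finset.sortedLT_sort _).pairwise⟩
    obtain ⟨z, hz⟩ := hF i hi
    have : z ∈ (F (i + 1)).sort (· ≤ ·) := by simpa using hz
    rw [h0] at this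
    simp at this
  · rw [rows_ofRows, ← h]
    split_ifs with hi
    · rfl
    · exact (hF' i (not_lt.1 hi)).symm

theorem IsNTableau.leftInsert_eq {T : List (List A)} (hT : IsNTableau T) (x : A) :
    leftInsert x T = nAlg (FreeMonoid.of x * rowWord T) := by
  have hmem := mem_rows_nAlg_mul hT x
  have hstrict := (isNTableau_iff.1 (nAlg_spec (FreeMonoid.of x * rowWord T).toList).1).1
  obtain ⟨hS, hN⟩ := isNTableau_iff.1 hT
  have hnest : ∀ i, 1 ≤ i → ∀ z ∈ row T (i + 1), z ∈ row T i ∧ ∃ u ∈ row T i, u < z := by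
    intro i hi z hz
    obtain ⟨j, rfl⟩ := Nat.exists_eq_add_of_le' hi
    exact hN j z hz
  have hlen : ∀ i z, z ∈ row T i → i ≤ T.length := by
    intro i z hz
    cases i with
    | zero => exact Nat.zero_le _
    | succ i => exact (mem_rows.1 hz).1
  have hne : ∀ i < T.length, (row T (i + 1)).Nonempty := by
    intro i hi
    obtain ⟨z, hz⟩ := List.exists_mem_of_ne_nil _ (hS _ (List.getElem_mem hi)).1
    exact ⟨z, mem_rows.2 ⟨hi, hz⟩⟩
  have hemp : ∀ i, T.length ≤ i → row T (i + 1) = ∅ := fun i hi =>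
    Finset.eq_empty_iff_forall_notMem.2 fun z hz => by have := hlen _ z hz; omega
  have hp : ∀ i, (∃ u ∈ row T i, u < x) ↔
      1 ≤ i ∧ i ≤ Nat.findGreatest (fun i => (row T i).min < (x : WithTop A)) T.length := by
    intro i
    rw [← min_lt_coe]
    refine iff_le_findGreatest (P := fun i => (row T i).min < (x : WithTop A)) ?_ ?_ ?_ i
    · simp [row]
    · intro i hi
      obtain ⟨u, hu, -⟩ := min_lt_coe.1 hi
      exact hlen i u hu
    · intro i hi h
      obtain ⟨u, hu, hux⟩ := min_lt_coe.1 h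
      exact min_lt_coe.2 ⟨u, (hnest i hi u hu).1, hux⟩
  have hr : ∀ i, x ∈ row T i ↔ 1 ≤ i ∧ i ≤ Nat.findGreatest (fun i => x ∈ row T i) T.length :=
    iff_le_findGreatest (by simp [row]) (fun i => hlen i x) fun i hi h => (hnest i hi x h).1
  unfold leftInsert
  set t' := Nat.findGreatest (fun i => (row T i).min < (x : WithTop A)) T.length with ht'
  set r := Nat.findGreatest (fun i => x ∈ row T i) T.length with hr'
  have hxt : ∀ i, x ∈ row T (i + 1) → i ≤ t' := by
    intro i hx
    rcases Nat.eq_zero_or_pos i with rfl | hi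
    · exact Nat.zero_le _
    · exact ((hp i).1 (hnest i hi x hx).2).2
  have hge : ∀ i, t' < i → ∀ u ∈ row T i, x ≤ u := by
    intro i hi u hu
    by_contra hc
    exact absurd ((hp i).1 ⟨u, hu, not_le.1 hc⟩).2 hi.not_ge
  have hmem' : ∀ i z, z ∈ rows (nAlg (FreeMonoid.of x * rowWord T)) i ↔
      (z = x ∧ i ≤ t') ∨
        (z ≠ x ∧ z ∈ row T (i + 1) ∧ (z < x ∨ i = 0 ∨ ∃ u ∈ row T i, x ≤ u ∧ u < z)) := by
    intro i z
    rw [hmem, hp, show (i = 0 ∨ 1 ≤ i ∧ i ≤ t') ↔ i ≤ t' by omega]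
  simp only
  split_ifs with h1 h2
  · have ht0 : t' = 0 := by
      by_contra hc
      obtain ⟨u, hu, hux⟩ := (hp 1).2 ⟨le_rfl, Nat.one_le_iff_ne_zero.2 hc⟩
      exact absurd (h1.trans (Finset.min_le hu)) (not_le.2 (WithTop.coe_lt_coe.2 hux))
    refine hstrict.ofRows_eq ?_ ?_ ?_
    · intro i hi
      rcases Nat.eq_zero_or_pos i with rfl | h0
      · simp
      · rw [if_neg (by omega)]
        exact hne i (by omega)
    · intro i hi
      rw [if_neg (by omega)]
      exact hemp i (by omega)
    · intro i
      ext z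
      rw [show FreeMonoid.toList _ = FreeMonoid.toList (FreeMonoid.of x * rowWord T) from rfl]
      refine Iff.trans ?_ (hmem' i z).symm
      rw [ht0]
      rcases Nat.eq_zero_or_pos i with rfl | h0
      · simp
        tauto
      · rw [if_neg (by omega)]
        constructor
        · intro hz
          refine Or.inr ⟨?_, hz, Or.inr (Or.inr ?_)⟩
          · rintro rfl
            have := hxt i hz
            omega
          · obtain ⟨-, u, hu, huz⟩ := hnest i h0 z hz
            exact ⟨u, hu, hge i (by omega) u hu, huz⟩
        · rintro (⟨-, h⟩ | ⟨-, h, -⟩)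
          · omega
          · exact h
  -- Maximality of t' excludes p_t < x, so this case is exactly p_t = x.
  · have hx : x ∈ row T (t' + 1) := by
      have h3 : ¬ (row T (t' + 1)).min < (x : WithTop A) := fun h => by
        have := ((hp _).1 (min_lt_coe.1 h)).2
        omega
      exact Finset.mem_of_min (h2.eq_of_not_lt h3)
    refine hS.ext hstrict fun i => ?_
    ext z
    refine Iff.trans ?_ (hmem' i z).symm
    have hxi : ∀ i, 1 ≤ i → i ≤ t' + 1 → x ∈ row T i := by
      intro i h0 hi
      have := (hr _).1 hx
      exact (hr i).2 ⟨h0, by omega⟩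
    constructor
    · intro hz
      by_cases hzx : z = x
      · subst hzx
        exact Or.inl ⟨rfl, hxt i hz⟩
      · refine Or.inr ⟨hzx, hz, ?_⟩
        rcases lt_or_gt_of_ne hzx with h | h
        · exact Or.inl h
        · refine Or.inr ((Nat.eq_zero_or_pos i).imp_right fun h0 => ?_)
          by_cases hi : i ≤ t' + 1
          · exact ⟨x, hxi i h0 hi, le_rfl, h⟩
          · obtain ⟨-, u, hu, huz⟩ := hnest i h0 z hz
            exact ⟨u, hu, hge i (by omega) u hu, huz⟩
    · rintro (⟨rfl, h⟩ | ⟨-, h, -⟩)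
      · exact hxi (i + 1) (by omega) (by omega)
      · exact h
  · have hF : ∀ i z, z ∈ (if r + 2 ≤ i + 1 ∧ i + 1 ≤ t' + 1 ∧ above x (row T (i + 1)) ≠ ⊤ ∧
          above x (row T (i + 1)) = above x (row T (i + 1 - 1)) then
        (if r + 1 ≤ i + 1 ∧ i + 1 ≤ t' + 1 then insert x (row T (i + 1)) else
          row T (i + 1)).filter (fun z : A => (z : WithTop A) ≠ above x (row T (i + 1)))
        else if r + 1 ≤ i + 1 ∧ i + 1 ≤ t' + 1 then insert x (row T (i + 1)) else
          row T (i + 1)) ↔ z ∈ rows (nAlg (FreeMonoid.of x * rowWord T)) i := by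
      intro i z
      rw [hmem']
      have hins : z ∈ (if r + 1 ≤ i + 1 ∧ i + 1 ≤ t' + 1 then insert x (row T (i + 1)) else
          row T (i + 1)) ↔ (z = x ∧ i ≤ t') ∨ z ∈ row T (i + 1) := by
        split_ifs with h
        · rw [Finset.mem_insert]
          exact or_congr_left ⟨fun h' => ⟨h', by omega⟩, And.left⟩
        · refine ⟨Or.inr, ?_⟩
          rintro (⟨rfl, h'⟩ | h')
          · exact (hr _).2 ⟨by omega, by omega⟩
          · exact h'
      -- A letter z > x is lost exactly when every smaller letter in the row below is < x: then x is
      -- not in that row, and z is the smallest letter > x in both rows.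
      have hrem : z ∈ row T (i + 1) → z ≠ x → ((r + 2 ≤ i + 1 ∧ i + 1 ≤ t' + 1 ∧
          above x (row T (i + 1)) ≠ ⊤ ∧
          above x (row T (i + 1)) = above x (row T (i + 1 - 1))) ∧
          (z : WithTop A) = above x (row T (i + 1)) ↔
          ¬ (z < x ∨ i = 0 ∨ ∃ u ∈ row T i, x ≤ u ∧ u < z)) := by
        intro hz hzx
        rw [Nat.add_sub_cancel]
        constructor
        · rintro ⟨⟨h3, h4, h5, h6⟩, h7⟩ h8
          rw [← h7] at h6
          obtain ⟨-, h9, -⟩ := above_eq_coe.1 h7.symm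
          obtain ⟨-, -, h10⟩ := above_eq_coe.1 h6.symm
          rcases h8 with h8 | h8 | ⟨u, hu, hxu, huz⟩
          · exact h8.not_gt h9
          · omega
          · rcases hxu.eq_or_lt with rfl | hxu
            · have := ((hr i).1 hu).2
              omega
            · exact (h10 u hu hxu).not_gt huz
        · intro h3
          push Not at h3
          obtain ⟨h3, h4, h5⟩ := h3
          have h6 : x < z := h3.lt_of_ne' hzx
          have h0 : 1 ≤ i := Nat.one_le_iff_ne_zero.2 h4
          obtain ⟨hz', u, hu, huz⟩ := hnest i h0 z hz
          have h7 : ¬ x ∈ row T i := fun h => (h5 x h le_rfl).not_gt h6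
          have h8 : u < x := not_le.1 fun h => (h5 u hu h).not_gt huz
          have h9 := ((hp i).1 ⟨u, hu, h8⟩).2
          have h10 : ¬ i ≤ r := fun h => h7 ((hr i).2 ⟨h0, h⟩)
          have h11 : above x (row T i) = (z : WithTop A) :=
            above_eq_coe.2 ⟨hz', h6, fun y hy hy' => h5 y hy hy'.le⟩
          have h12 : above x (row T (i + 1)) = (z : WithTop A) :=
            above_eq_coe.2 ⟨hz, h6, fun y hy hy' => h5 y (hnest i h0 y hy).1 hy'.le⟩
          rw [h11, h12]
          exact ⟨⟨by omega, by omega, WithTop.coe_ne_top, rfl⟩, rfl⟩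
      have hx : (x : WithTop A) ≠ above x (row T (i + 1)) := fun h =>
        lt_irrefl x (above_eq_coe.1 h.symm).2.1
      rw [mem_ite_filter, hins]
      by_cases hzx : z = x
      · subst hzx
        have h3 : z ∈ row T (i + 1) → i ≤ t' := hxt i
        constructor
        · rintro ⟨h4 | h4, -⟩
          · exact Or.inl h4
          · exact Or.inl ⟨rfl, h3 h4⟩
        · rintro (h4 | h4)
          · exact ⟨Or.inl h4, fun _ => hx⟩
          · exact absurd rfl h4.1
      · rw [or_iff_right (fun h => hzx h.1), or_iff_right (fun h => hzx h.1)]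
        refine (and_congr_right fun hz => ?_).trans (and_iff_right hzx).symm
        exact not_and.symm.trans ((not_congr (hrem hz hzx)).trans not_not)
    refine hstrict.ofRows_eq ?_ ?_ fun i => Finset.ext (hF i)
    · intro i hi
      by_cases h : i ≤ t'
      · exact ⟨x, (hF i x).2 ((hmem' i x).2 (Or.inl ⟨rfl, h⟩))⟩
      · obtain ⟨z, hz⟩ := hne i (by omega)
        refine ⟨z, ?_⟩
        rw [if_neg (by omega), if_neg (by omega)]
        exact hz
    · intro i hi
      rw [if_neg (by omega), if_neg (by omega)]
      exact hemp i (by omega)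

end

end Stylic

/-! ### The bijection with the stylic monoid -/

theorem theorem11p5 {A : Type*} [LinearOrder A] [Finite A] :
    (∀ (T : List (List A)) (x : A), Stylic.IsNTableau T →
      Stylic.IsNTableau (Stylic.leftInsert x T) ∧
      Stylic.leftInsert x T = Stylic.nAlg (FreeMonoid.of x * Stylic.rowWord T)) ∧
    ∃ Φ : Stylic.Styl A ≃ {T : List (List A) // Stylic.IsNTableau T},
      (∀ w : FreeMonoid A, (Φ (Stylic.mu w) : List (List A)) = Stylic.nAlg w) ∧
      (∀ T : {T : List (List A) // Stylic.IsNTableau T},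
        Φ.symm T = Stylic.mu (Stylic.rowWord (T : List (List A)))) ∧
      ∀ (x : A) (m : Stylic.Styl A),
        (Φ (Stylic.mu (FreeMonoid.of x) * m) : List (List A)) =
          Stylic.leftInsert x (Φ m : List (List A)) := by
  have hN : ∀ w : FreeMonoid A, Stylic.IsNTableau (Stylic.nAlg w) :=
    fun w => (Stylic.nAlg_spec w.toList).1
  have hmu : ∀ w : FreeMonoid A, Stylic.mu (Stylic.rowWord (Stylic.nAlg w)) = Stylic.mu w :=
    fun w => (Stylic.mu_eq_iff _ _).2 (hN w).nAlg_rowWord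
  have hsurj : Function.Surjective (Stylic.mu (A := A)) := MonoidHom.mrangeRestrict_surjective _
  -- The inverse T ↦ μ(r(T)) is the map constructed first; Φ is then its inverse equivalence.
  have hbij : Function.Bijective (fun T : {T : List (List A) // Stylic.IsNTableau T} =>
      Stylic.mu (Stylic.rowWord (T : List (List A)))) := by
    refine ⟨fun T T' h => Subtype.ext ?_, fun m => ?_⟩
    · rw [← T.2.nAlg_rowWord, ← T'.2.nAlg_rowWord]
      exact (Stylic.mu_eq_iff _ _).1 h
    · obtain ⟨w, rfl⟩ := hsurj m
      exact ⟨⟨Stylic.nAlg w, hN w⟩, hmu w⟩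
  let Ψ := Equiv.ofBijective _ hbij
  have hΦ : ∀ w : FreeMonoid A, Ψ.symm (Stylic.mu w) = ⟨Stylic.nAlg w, hN w⟩ :=
    fun w => Ψ.symm_apply_eq.2 (hmu w).symm
  refine ⟨fun T x hT => ⟨?_, hT.leftInsert_eq x⟩, Ψ.symm, fun w => by rw [hΦ], fun T => rfl, ?_⟩
  · rw [hT.leftInsert_eq x]
    exact hN _
  · intro x m
    obtain ⟨w, rfl⟩ := hsurj m
    rw [← map_mul, hΦ, hΦ, (hN w).leftInsert_eq x]
    -- It remains that x w and x r(N(w)) have the same image under μ, which follows from μ(r(N(w)))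
    -- = μ(w).
    refine (Stylic.mu_eq_iff _ _).1 ?_
    rw [map_mul, map_mul, hmu]
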